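/- **Setting.** Fix $R,L,S>0$. In each round $t=1,\dots,T$ a learner chooses an action $X_t$ in the ball $D=\{x\in\mathbb R^d:\|x\|\le L\}$ and observes $Y_t=\langle X_t,\theta_t\rangle+\eta_t$, with $\eta_t$ i.i.d. $N(0,R^2)$ (a sub-Gaussian law with variance proxy $R$). A policy $\pi$ chooses $X_t$, possibly at random, on the basis of $X_1,Y_1,\dots,X_{t-1},Y_{t-1}$; it may depend on $d$, $T$, $B_T$, $R$, $L$, $S$. Let $\Theta(B_T)$ be the set of sequences $\theta_1,\dots,\theta_T\in\mathbb R^d$ with $\|\theta_t\|\le S$ and $|\langle x,\theta_t\rangle|\le 1$ for all $x\in D$ and all $t$, and $\sum_{t=1}^{T-1}\|\theta_{t+1}-\theta_t\|\le B_T$. For a class $C$ of sequences put $$\mathcal R_T(\pi;C)=\sup_{\theta_{1:T}\in C}\mathbf E\Big[\sum_{t=1}^T\Big(\max_{x\in D}\langle x,\theta_t\rangle-\langle X_t,\theta_t\rangle\Big)\Big],$$ and let $\mathcal R_T(\pi)=\mathcal R_T(\pi;\Theta(B_T))$ be the dynamic regret. **Theorem.** There is a constant $c>0$ that depends only on $R,L,S$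 such that the following hold. 1. For all $d\ge1$, all $T\ge d$, all $B_T>0$ and every policy $\pi$, $$\mathcal R_T(\pi)\ \ge\ c\,\min\big\{T,\ d^{2/3}B_T^{1/3}T^{2/3}\big\}.$$ In particular $\mathcal R_T(\pi)\ge c\,d^{2/3}B_T^{1/3}T^{2/3}$ whenever $d^2B_T\le T$. 2. Let $d\ge 1$ be fixed and let $(B_T)_{T}$ be positive with $B_T=\Theta(T^\rho)$ for some $\rho\in(0,1)$. Then for all sufficiently large $T$ every policy satisfies $\mathcal R_T(\pi)\ge c\,d^{2/3}B_T^{1/3}T^{2/3}$; and there is $c'>0$, which may depend on $R,L,S$, on $d$ and on the sequence $(B_T)$, such that $\mathcal R_T(\pi)\ge c'\,d^{2/3}B_T^{1/3}T^{2/3}$ for all $T\ge d$ and every policy $\pi$. 3. Let $d\ge1$, $T\ge d$, $0<B_T\le dT$ and $H=\lceil (dT/B_T)^{2/3}\rceil$, and suppose that $d/(2\sqrt H)\le S$ and $L\,d/(2\sqrt H)\le1$. Let $C_H$ be the set of those $\theta_{1:T}\in\Theta(B_T)$ that are constant on each of the consecutive blocks of $H$ rounds (the last block may be shorter) and take all their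 values in $\{\pm\sqrt{d/(4H)}\}^d$. Then $\mathcal R_T(\pi;C_H)\ge c\,d^{2/3}B_T^{1/3}T^{2/3}$ for every policy $\pi$. -/

import Mathlib

open MeasureTheory ProbabilityTheory Filter Asymptotics

noncomputable section

namespace DriftingBandit

/-- Actions and parameters live in Euclidean `ℝ^d`. -/
abbrev Vec (d : ℕ) : Type := EuclideanSpace ℝ (Fin d)

/-- A history of `n` rounds: the actions played and the rewards observed. Rounds are numbered from
`0`, so round `t` here is round `t + 1` in the usual numbering. -/
abbrev History (d n : ℕ) : Type := Fin n → Vec d × ℝ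

/-- A (randomized, history dependent) policy for the decision sets `D 0, D 1, …`: in round `n` the
action is drawn from a probability distribution on `D n` that depends measurably on the history of
the first `n` rounds. -/
structure Policy (d : ℕ) (D : ℕ → Set (Vec d)) where
  act : (n : ℕ) → Kernel (History d n) (Vec d)
  markov : ∀ n, IsMarkovKernel (act n)
  mem : ∀ n h, ∀ᵐ x ∂(act n h), x ∈ D n

variable {d : ℕ} {D : ℕ → Set (Vec d)}

/-- Law of the pair (action, reward) of round `n` given the past: the action `x` comes from the
policy, the noise `η` has law `ν` and is independent of the past and of `x`, and the reward is
`⟪x, θ n⟫ + η`. -/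
def roundKernel (π : Policy d D) (ν : Measure ℝ) (θ : ℕ → Vec d) (n : ℕ) :
    Kernel (History d n) (Vec d × ℝ) :=
  ((π.act n) ×ₖ (Kernel.const (History d n) ν)).map
    (fun p : Vec d × ℝ => (p.1, inner ℝ p.1 (θ n) + p.2))

/-- Law of the history of the first `n` rounds when policy `π` is run against the parameter
sequence `θ` with i.i.d. noise of law `ν`. -/
def historyLaw (π : Policy d D) (ν : Measure ℝ) (θ : ℕ → Vec d) : (n : ℕ) → Measure (History d n)
  | 0 => Measure.dirac (fun i => i.elim0)
  | n + 1 => ((historyLaw π ν θ n) ⊗ₘ (roundKernel π ν θ n)).map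
      (fun p : History d n × (Vec d × ℝ) =>
        (Fin.snoc (α := fun _ => Vec d × ℝ) p.1 p.2 : History d (n + 1)))

/-- Expected cumulative regret over `T` rounds, against the best action of every single round. -/
def expectedRegret (π : Policy d D) (ν : Measure ℝ) (T : ℕ) (θ : ℕ → Vec d) : ℝ :=
  ∫ h : History d T,
    ∑ t : Fin T, ((⨆ x : D t, inner ℝ (x : Vec d) (θ t)) - inner ℝ (h t).1 (θ t))
    ∂(historyLaw π ν θ T)

/-- Dynamic regret over `T` rounds: worst case of the expected regret over a class of parameter
sequences. -/
def dynamicRegret (π : Policy d D) (ν : Measure ℝ) (T : ℕ) (C : Set (ℕ → Vec d)) : EReal :=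
  ⨆ θ ∈ C, (expectedRegret π ν T θ : EReal)

/-- Total variation of a parameter sequence over the rounds `0, …, T - 1`. -/
def variation (T : ℕ) (θ : ℕ → Vec d) : ℝ :=
  ∑ t ∈ Finset.range (T - 1), ‖θ (t + 1) - θ t‖

/-- The admissible parameter sequences: norms at most `S`, mean rewards in `[-1, 1]`, and total
variation at most `B`. Only the first `T` rounds are constrained. -/
def admissible (D : ℕ → Set (Vec d)) (S : ℝ) (T : ℕ) (B : ℝ) : Set (ℕ → Vec d) :=
  {θ | (∀ t < T, ‖θ t‖ ≤ S ∧ ∀ x ∈ D t, |inner ℝ x (θ t)| ≤ 1) ∧ variation T θ ≤ B}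

/-- The sequences that are constant on consecutive blocks of `H` rounds (the last block may be
shorter), with all values in `{± √(d / (4 H))} ^ d`. -/
def blockSequences (d T H : ℕ) : Set (ℕ → Vec d) :=
  {θ | ∃ β : ℕ → Vec d,
    (∀ j i, β j i = √((d : ℝ) / (4 * H)) ∨ β j i = -√((d : ℝ) / (4 * H))) ∧
    ∀ t < T, θ t = β (t / H)}

/-- Every round offers the closed Euclidean ball of radius `L`. -/
def ballSets (d : ℕ) (L : ℝ) : ℕ → Set (Vec d) := fun _ => Metric.closedBall 0 L

/-- Centered Gaussian noise of standard deviation `R`, the standard sub-Gaussian law with variance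
proxy `R`. -/
def noise (R : ℝ) : Measure ℝ := gaussianReal 0 (Real.toNNReal (R ^ 2))

/-- The rate `d^(2/3) B^(1/3) T^(2/3)`. -/
def rate (d T : ℕ) (B : ℝ) : ℝ :=
  (d : ℝ) ^ (2 / 3 : ℝ) * B ^ (1 / 3 : ℝ) * (T : ℝ) ^ (2 / 3 : ℝ)

/-- The block length `⌈(d T / B)^(2/3)⌉`. -/
def blockLength (d T : ℕ) (B : ℝ) : ℕ := ⌈((d : ℝ) * T / B) ^ (2 / 3 : ℝ)⌉₊

end DriftingBandit

end

/-! The hard instances freeze the parameter on blocks of `H` rounds and choose it there among the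
vertices of the cube `{±a}^d`. Flipping the sign of coordinate `i` on a block moves the mean reward
by `2a|x_i|`, so the flip is visible only through the sum of `x_i²` over that block. The ball limits
the total energy of a block to `H L²`, and `d` coordinates share it: if `a² ≤ d/(4H)`, the
information per coordinate is on average at most `L²/(2R²)`, whatever the policy does
(`sum_infoGain_le`). Hence the signs cannot be learned reliably.

On a ball, instantaneous regret dominates the squared distance to the optimal action, and this
distance splits over coordinates (`le_instantRegret`). Combining a two-point bound for each sign
(`mul_integral_exp_neg_infoGain_le`) with an average over all sign patterns gives a sequence with
regret of order `a√d T` (`exists_cubeSeq_le_expectedRegret`).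

A change of block costs at most `2a√d` of variation. At full amplitude `a√d = d/(2√H)` the budget is
respected once `H^(3/2) ≥ dT/B`, and the regret `dT/√H` is then of the order of the rate. Capping
`a√d` by `S` and `1/L` is what turns the rate into `min(T, rate)`. -/

noncomputable section

namespace DriftingBandit

open scoped ENNReal NNReal symmDiff

/-! ### Gaussian change of measure for history laws. -/

/-- A Gaussian shift as an exponential tilt. -/
lemma lintegral_gaussianReal_const_add {v : ℝ≥0} (hv : v ≠ 0) (m : ℝ) {F : ℝ → ℝ≥0∞}
    (hF : Measurable F) :
    ∫⁻ η, F (m + η) ∂(gaussianReal 0 v) =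
      ∫⁻ y, F y * ENNReal.ofReal (Real.exp (y * m / v - m ^ 2 / (2 * v))) ∂(gaussianReal 0 v) := by
  have hv' : (v : ℝ) ≠ 0 := by exact_mod_cast hv
  have h1 : ∫⁻ η, F (m + η) ∂(gaussianReal 0 v) = ∫⁻ y, F y ∂(gaussianReal m v) := by
    have := gaussianReal_map_const_add (μ := 0) (v := v) m
    rw [zero_add] at this
    rw [← this, lintegral_map hF (by fun_prop)]
  rw [h1, gaussianReal_of_var_ne_zero _ hv, gaussianReal_of_var_ne_zero _ hv,
    lintegral_withDensity_eq_lintegral_mul _ (measurable_gaussianPDF _ _) hF,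
    lintegral_withDensity_eq_lintegral_mul _ (measurable_gaussianPDF _ _)
      (by fun_prop)]
  refine lintegral_congr fun y => ?_
  simp only [Pi.mul_apply, gaussianPDF]
  rw [mul_comm (F y), ← mul_assoc, ← ENNReal.ofReal_mul (gaussianPDFReal_nonneg _ _ _)]
  congr 2
  simp only [gaussianPDFReal]
  rw [mul_assoc _ (Real.exp _), ← Real.exp_add]
  congr 2
  field_simp
  ring

variable {d : ℕ} {D : ℕ → Set (Vec d)}

instance isProbabilityMeasure_noise (R : ℝ) : IsProbabilityMeasure (noise R) := by
  unfold noise; infer_instance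

lemma measurable_snoc (n : ℕ) : Measurable (fun p : History d n × (Vec d × ℝ) =>
    (Fin.snoc (α := fun _ => Vec d × ℝ) p.1 p.2 : History d (n + 1))) := by
  refine measurable_pi_iff.2 fun i => ?_
  refine Fin.lastCases ?_ (fun j => ?_) i
  · simpa using measurable_snd
  · simp only [Fin.snoc_castSucc]
    fun_prop

lemma measurable_reward (v : Vec d) : Measurable (fun p : Vec d × ℝ =>
    ((p.1, inner ℝ p.1 v + p.2) : Vec d × ℝ)) := by
  fun_prop

instance isMarkovKernel_roundKernel (π : Policy d D) (ν : Measure ℝ) [IsProbabilityMeasure ν]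
    (θ : ℕ → Vec d) (n : ℕ) : IsMarkovKernel (roundKernel π ν θ n) := by
  have := π.markov n
  exact Kernel.IsMarkovKernel.map _ (measurable_reward (θ n))

instance isProbabilityMeasure_historyLaw (π : Policy d D) (ν : Measure ℝ) [IsProbabilityMeasure ν]
    (θ : ℕ → Vec d) (n : ℕ) : IsProbabilityMeasure (historyLaw π ν θ n) := by
  induction n with
  | zero => rw [historyLaw]; infer_instance
  | succ n ih =>
    rw [historyLaw]
    exact Measure.isProbabilityMeasure_map (measurable_snoc n).aemeasurable

lemma lintegral_historyLaw_succ (π : Policy d D) (ν : Measure ℝ) [IsProbabilityMeasure ν]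
    (θ : ℕ → Vec d) (n : ℕ) {F : History d (n + 1) → ℝ≥0∞} (hF : Measurable F) :
    ∫⁻ h, F h ∂(historyLaw π ν θ (n + 1)) =
      ∫⁻ h, ∫⁻ x, ∫⁻ η, F (Fin.snoc (α := fun _ => Vec d × ℝ) h (x, inner ℝ x (θ n) + η))
        ∂ν ∂(π.act n h) ∂(historyLaw π ν θ n) := by
  have := π.markov n
  have hs : Measurable (fun p : History d n × (Vec d × ℝ) =>
      F (Fin.snoc (α := fun _ => Vec d × ℝ) p.1 p.2)) := hF.comp (measurable_snoc (d := d) n)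
  rw [historyLaw, lintegral_map hF (measurable_snoc n), Measure.lintegral_compProd hs]
  refine lintegral_congr fun h => ?_
  have hh : Measurable (fun q : Vec d × ℝ => F (Fin.snoc (α := fun _ => Vec d × ℝ) h q)) :=
    hs.comp (measurable_const.prodMk measurable_id)
  have hr : Measurable (fun q : Vec d × ℝ =>
      F (Fin.snoc (α := fun _ => Vec d × ℝ) h (q.1, inner ℝ q.1 (θ n) + q.2))) :=
    hh.comp (measurable_reward (θ n))
  rw [roundKernel, Kernel.lintegral_map _ (measurable_reward (θ n)) _ hh,
    Kernel.lintegral_prod _ _ _ hr]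
  simp

/-- Log-likelihood of a history under Gaussian rewards, relative to the parameter `0`. -/
def logLik (R : ℝ) (θ : ℕ → Vec d) (n : ℕ) (h : History d n) : ℝ :=
  ∑ t : Fin n, ((h t).2 * inner ℝ (h t).1 (θ t) / R ^ 2
    - (inner ℝ (h t).1 (θ t)) ^ 2 / (2 * R ^ 2))

lemma measurable_logLik (R : ℝ) (θ : ℕ → Vec d) (n : ℕ) : Measurable (logLik R θ n) := by
  unfold logLik; fun_prop

lemma lintegral_historyLaw_succ_tilted (π : Policy d D) {R : ℝ} (hR : 0 < R)
    (θ : ℕ → Vec d) (n : ℕ) {F : History d (n + 1) → ℝ≥0∞} (hF : Measurable F) :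
    ∫⁻ h, F h ∂(historyLaw π (noise R) θ (n + 1)) =
      ∫⁻ h, ∫⁻ x, ∫⁻ y, F (Fin.snoc (α := fun _ => Vec d × ℝ) h (x, y)) *
          ENNReal.ofReal (Real.exp (y * inner ℝ x (θ n) / R ^ 2
            - (inner ℝ x (θ n)) ^ 2 / (2 * R ^ 2)))
        ∂(noise R) ∂(π.act n h) ∂(historyLaw π (noise R) θ n) := by
  rw [lintegral_historyLaw_succ π _ θ n hF]
  refine lintegral_congr fun h => lintegral_congr fun x => ?_
  have hv : Real.toNNReal (R ^ 2) ≠ 0 := by simp [hR.ne']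
  have hh : Measurable (fun y : ℝ => F (Fin.snoc (α := fun _ => Vec d × ℝ) h (x, y))) :=
    (hF.comp (measurable_snoc (d := d) n)).comp
      (measurable_const.prodMk (measurable_const.prodMk measurable_id))
  have := lintegral_gaussianReal_const_add hv (inner ℝ x (θ n)) hh
  rw [Real.coe_toNNReal _ (sq_nonneg R)] at this
  exact this

/-- The policy kernels do not depend on the parameter, so only the reward of each round contributes
a factor: the density of a shifted Gaussian against the pure noise seen under the parameter `0`. -/
lemma lintegral_historyLaw_eq (π : Policy d D) {R : ℝ} (hR : 0 < R)
    (θ : ℕ → Vec d) (n : ℕ) {F : History d n → ℝ≥0∞} (hF : Measurable F) :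
    ∫⁻ h, F h ∂(historyLaw π (noise R) θ n) =
      ∫⁻ h, F h * ENNReal.ofReal (Real.exp (logLik R θ n h))
        ∂(historyLaw π (noise R) (fun _ => 0) n) := by
  induction n with
  | zero => simp [historyLaw, logLik]
  | succ n ih =>
    have := π.markov n
    have hw : Measurable (fun h => F h * ENNReal.ofReal (Real.exp (logLik R θ (n + 1) h))) := by
      have := measurable_logLik R θ (n + 1)
      fun_prop
    have hG : Measurable (fun q : History d n × (Vec d × ℝ) =>
        F (Fin.snoc (α := fun _ => Vec d × ℝ) q.1 q.2) *
          ENNReal.ofReal (Real.exp (q.2.2 * inner ℝ q.2.1 (θ n) / R ^ 2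
            - (inner ℝ q.2.1 (θ n)) ^ 2 / (2 * R ^ 2)))) := by
      have := hF.comp (measurable_snoc (d := d) n)
      exact this.mul (by fun_prop)
    have hG1 : Measurable (fun q : History d n × Vec d => ∫⁻ y,
        F (Fin.snoc (α := fun _ => Vec d × ℝ) q.1 (q.2, y)) *
          ENNReal.ofReal (Real.exp (y * inner ℝ q.2 (θ n) / R ^ 2
            - (inner ℝ q.2 (θ n)) ^ 2 / (2 * R ^ 2))) ∂(noise R)) := by
      refine Measurable.lintegral_prod_right' (f := fun r : (History d n × Vec d) × ℝ =>
        F (Fin.snoc (α := fun _ => Vec d × ℝ) r.1.1 (r.1.2, r.2)) *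
          ENNReal.ofReal (Real.exp (r.2 * inner ℝ r.1.2 (θ n) / R ^ 2
            - (inner ℝ r.1.2 (θ n)) ^ 2 / (2 * R ^ 2)))) ?_
      exact hG.comp (f := fun r : (History d n × Vec d) × ℝ => (r.1.1, (r.1.2, r.2)))
        (by fun_prop)
    -- The last round is integrated out first; what remains is a function of the first `n` rounds,
    -- to which the induction hypothesis applies.
    rw [lintegral_historyLaw_succ_tilted π hR θ n hF, lintegral_historyLaw_succ π _ _ n hw,
      ih (Measurable.lintegral_kernel_prod_right hG1)]
    refine lintegral_congr fun h => ?_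
    have hx : Measurable fun x => _ :=
      hG1.comp (measurable_const (a := h).prodMk measurable_id)
    simp only [Function.comp_def, id_eq] at hx
    rw [← lintegral_mul_const _ hx]
    refine lintegral_congr fun x => ?_
    have hy : Measurable fun y => _ := hG.comp
      (measurable_const (a := h).prodMk (measurable_const (a := x).prodMk measurable_id))
    simp only [Function.comp_def, id_eq] at hy
    rw [← lintegral_mul_const _ hy]
    refine lintegral_congr fun y => ?_
    rw [mul_assoc, ← ENNReal.ofReal_mul (Real.exp_pos _).le, ← Real.exp_add]
    simp only [logLik, Fin.sum_univ_castSucc, Fin.snoc_castSucc, Fin.snoc_last, inner_zero_right,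
      zero_add, Fin.val_castSucc, Fin.val_last]
    congr 3
    exact add_comm _ _

/-- Change of measure: the law of the history has an explicit density with respect to the law under
the parameter `0`. -/
lemma historyLaw_eq_withDensity (π : Policy d D) {R : ℝ} (hR : 0 < R) (θ : ℕ → Vec d) (n : ℕ) :
    historyLaw π (noise R) θ n = (historyLaw π (noise R) (fun _ => 0) n).withDensity
      (fun h => ENNReal.ofReal (Real.exp (logLik R θ n h))) := by
  ext s hs
  rw [withDensity_apply _ hs, ← lintegral_indicator_one hs,
    lintegral_historyLaw_eq π hR θ n (measurable_one.indicator hs), ← lintegral_indicator hs]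
  refine lintegral_congr fun h => ?_
  by_cases h' : h ∈ s <;> simp [h']

lemma ae_mem_of_historyLaw {D : ℕ → Set (Vec d)} (hD : ∀ n, MeasurableSet (D n)) (π : Policy d D)
    (ν : Measure ℝ) [IsProbabilityMeasure ν] (θ : ℕ → Vec d) (n : ℕ) :
    ∀ᵐ h ∂(historyLaw π ν θ n), ∀ t : Fin n, (h t).1 ∈ D t := by
  induction n with
  | zero => simp
  | succ n ih =>
    have hm : ∀ m, MeasurableSet {h : History d m | ∀ t : Fin m, (h t).1 ∈ D t} := fun m => by
      rw [Set.ofPred_forall]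
      exact MeasurableSet.iInter fun t => (by fun_prop : Measurable fun h : History d m => (h t).1)
        (hD t)
    have hF : Measurable ({h : History d (n + 1) | ∀ t : Fin (n + 1), (h t).1 ∈ D t}ᶜ.indicator
        (1 : History d (n + 1) → ℝ≥0∞)) := measurable_one.indicator (hm _).compl
    rw [ae_iff, ← Set.compl_ofPred, ← lintegral_indicator_one (hm _).compl,
      lintegral_historyLaw_succ π ν θ n hF]
    refine (lintegral_congr_ae ?_).trans lintegral_zero
    filter_upwards [ih] with h hh
    refine (lintegral_congr_ae ?_).trans lintegral_zero
    filter_upwards [π.mem n h] with x hx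
    refine (lintegral_congr fun η => ?_).trans lintegral_zero
    rw [Set.indicator_of_notMem]
    rw [Set.notMem_compl_iff]
    intro t
    refine Fin.lastCases ?_ (fun j => ?_) t
    · simpa using hx
    · simpa using hh j

/-! ### Integrability for actions in the ball. -/

variable {L R : ℝ}

lemma ae_norm_action_le (π : Policy d (ballSets d L)) (R : ℝ) (θ : ℕ → Vec d) (n : ℕ) :
    ∀ᵐ h ∂(historyLaw π (noise R) θ n), ∀ t : Fin n, ‖(h t).1‖ ≤ L := by
  filter_upwards [ae_mem_of_historyLaw (fun _ => Metric.isClosed_closedBall.measurableSet) π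
    (noise R) θ n] with h hh t
  simpa [ballSets] using hh t

lemma integrable_historyLaw (π : Policy d (ballSets d L)) (R : ℝ) (θ : ℕ → Vec d) {n : ℕ}
    {f : History d n → ℝ} (hf : Measurable f) {M : ℝ}
    (hM : ∀ h, (∀ t, ‖(h t).1‖ ≤ L) → |f h| ≤ M) :
    Integrable f (historyLaw π (noise R) θ n) := by
  refine Integrable.of_bound hf.aestronglyMeasurable M ?_
  filter_upwards [ae_norm_action_le π R θ n] with h hh
  exact hM h hh

lemma integral_historyLaw_eq (π : Policy d (ballSets d L)) (hR : 0 < R) (θ : ℕ → Vec d) {n : ℕ}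
    (f : History d n → ℝ) :
    ∫ h, f h ∂(historyLaw π (noise R) θ n) =
      ∫ h, Real.exp (logLik R θ n h) * f h ∂(historyLaw π (noise R) (fun _ => 0) n) := by
  have := measurable_logLik R θ n
  rw [historyLaw_eq_withDensity π hR θ n, integral_withDensity_eq_integral_toReal_smul
    (by fun_prop) (by simp)]
  simp [ENNReal.toReal_ofReal (Real.exp_pos _).le]

lemma integrable_exp_logLik_mul (π : Policy d (ballSets d L)) (hR : 0 < R) (θ : ℕ → Vec d) {n : ℕ}
    {f : History d n → ℝ} (hf : Integrable f (historyLaw π (noise R) θ n)) :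
    Integrable (fun h => Real.exp (logLik R θ n h) * f h)
      (historyLaw π (noise R) (fun _ => 0) n) := by
  have := measurable_logLik R θ n
  rw [historyLaw_eq_withDensity π hR θ n, integrable_withDensity_iff_integrable_smul'
    (by fun_prop) (by simp)] at hf
  simpa [ENNReal.toReal_ofReal (Real.exp_pos _).le] using hf

/-! ### The two-point method. -/

/-- Squared size of a perturbation `δ` of the parameters along the actions, in units of `2 R ^ 2`:
its mean is the Kullback–Leibler divergence caused by the perturbation. -/
def infoGain (R : ℝ) (δ : ℕ → Vec d) (n : ℕ) (h : History d n) : ℝ :=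
  ∑ t : Fin n, (inner ℝ (h t).1 (δ t)) ^ 2 / (2 * R ^ 2)

lemma measurable_infoGain (R : ℝ) (δ : ℕ → Vec d) (n : ℕ) : Measurable (infoGain R δ n) := by
  unfold infoGain; fun_prop

lemma infoGain_nonneg (R : ℝ) (δ : ℕ → Vec d) (n : ℕ) (h : History d n) :
    0 ≤ infoGain R δ n h :=
  Finset.sum_nonneg fun _ _ => by positivity

/-- The log-likelihood is linear minus quadratic in the parameter, so its symmetric second
difference contains no rewards. The reflected sequence `θ - δ` is only a device: its likelihood need
only have total mass one. -/
lemma logLik_add_add_logLik_sub (R : ℝ) (θ δ : ℕ → Vec d) (n : ℕ) (h : History d n) :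
    logLik R (θ + δ) n h + logLik R (θ - δ) n h =
      2 * logLik R θ n h - 2 * infoGain R δ n h := by
  simp only [logLik, infoGain, Finset.mul_sum, ← Finset.sum_add_distrib, ← Finset.sum_sub_distrib]
  refine Finset.sum_congr rfl fun t _ => ?_
  simp only [Pi.add_apply, Pi.sub_apply, inner_add_right, inner_sub_right]
  ring

/-- Pointwise form of the two-point bound: `p`, `q`, `r` are the likelihoods of `θ`, `θ + δ`, `θ -
δ`, and `e` is the exponential of minus the information. No logarithm of a likelihood ratio is ever
integrated. -/
lemma tilted_le_of_mul_eq {p q r e f g c l : ℝ} (hp : 0 < p) (hq : 0 < q) (hr : 0 < r)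
    (he : 0 ≤ e) (he1 : e ≤ 1) (h : (p * e) ^ 2 = q * r) (hf : 0 ≤ f) (hg : 0 ≤ g)
    (hc : 0 ≤ c) (hfg : c ≤ f + g) (hl : 0 < l) :
    c * (p * e) ≤ l / 2 * (p * f + q * g) + c / (2 * l) * (p + r) := by
  -- The witness is `m = min p q`.
  obtain ⟨m, hm, hm1, hm2⟩ : ∃ m, 0 < m ∧ c * m ≤ p * f + q * g ∧ (p * e) ^ 2 ≤ m * (p + r) := by
    rcases le_total p q with hpq | hpq
    · refine ⟨p, hp, ?_, ?_⟩
      · nlinarith [mul_le_mul_of_nonneg_right hpq hg]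
      · have : p * e ≤ p := by nlinarith
        have h0 : 0 ≤ p * e := by positivity
        nlinarith [mul_pos hp hr]
    · refine ⟨q, hq, ?_, ?_⟩
      · nlinarith [mul_le_mul_of_nonneg_right hpq hf]
      · nlinarith [mul_pos hp hq]
  -- The geometric mean of `m` and `p + r` is bounded by a weighted arithmetic mean with weight `l`.
  have key : p * e ≤ l / 2 * m + 1 / (2 * l) * (p + r) := by
    refine abs_le_of_sq_le_sq' ?_ (by positivity) |>.2
    have : m * (p + r) ≤ (l / 2 * m + 1 / (2 * l) * (p + r)) ^ 2 := by
      have h1 : m * (p + r) = 4 * (l / 2 * m) * (1 / (2 * l) * (p + r)) := by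
        field_simp; ring
      rw [h1]
      nlinarith [sq_nonneg (l / 2 * m - 1 / (2 * l) * (p + r))]
    linarith
  calc c * (p * e) ≤ c * (l / 2 * m + 1 / (2 * l) * (p + r)) := by gcongr
    _ = l / 2 * (c * m) + c / (2 * l) * (p + r) := by ring
    _ ≤ _ := by gcongr

/-- Two-point method: if `f + g ≥ c`, then `f` and `g` cannot both have small mean, one under `θ`
and the other under `θ + δ`. -/
lemma mul_integral_exp_neg_infoGain_le (π : Policy d (ballSets d L)) (hR : 0 < R)
    (θ δ : ℕ → Vec d) {n : ℕ} {f g : History d n → ℝ} (hf : ∀ h, 0 ≤ f h) (hg : ∀ h, 0 ≤ g h)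
    (hfi : Integrable f (historyLaw π (noise R) θ n))
    (hgi : Integrable g (historyLaw π (noise R) (θ + δ) n)) {c l : ℝ} (hc : 0 ≤ c)
    (hfg : ∀ h, c ≤ f h + g h) (hl : 0 < l) :
    c * ∫ h, Real.exp (-infoGain R δ n h) ∂(historyLaw π (noise R) θ n) ≤
      l / 2 * (∫ h, f h ∂(historyLaw π (noise R) θ n)
        + ∫ h, g h ∂(historyLaw π (noise R) (θ + δ) n)) + c / l := by
  have hone : ∀ θ : ℕ → Vec d, ∫ h, Real.exp (logLik R θ n h)
      ∂(historyLaw π (noise R) (fun _ => 0) n) = 1 := fun θ => by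
    have := integral_historyLaw_eq π hR θ (n := n) (fun _ => 1)
    simpa using this.symm
  have hint : ∀ θ : ℕ → Vec d, Integrable (fun h => Real.exp (logLik R θ n h))
      (historyLaw π (noise R) (fun _ => 0) n) := fun θ => by
    simpa using integrable_exp_logLik_mul π hR θ (n := n) (integrable_const (1 : ℝ))
  have he : Integrable (fun h => Real.exp (-infoGain R δ n h)) (historyLaw π (noise R) θ n) := by
    have := measurable_infoGain R δ n
    refine integrable_historyLaw π R θ (by fun_prop) (M := 1) fun h _ => ?_
    rw [abs_of_pos (Real.exp_pos _), Real.exp_le_one_iff]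
    linarith [infoGain_nonneg R δ n h]
  have he' := integrable_exp_logLik_mul π hR θ he
  have hf' := integrable_exp_logLik_mul π hR θ hfi
  have hg' := integrable_exp_logLik_mul π hR (θ + δ) hgi
  have hmono := integral_mono (he'.const_mul c)
    (((hf'.add hg').const_mul (l / 2)).add
      (((hint θ).add (hint (θ - δ))).const_mul (c / (2 * l)))) (fun h => by
      refine tilted_le_of_mul_eq (Real.exp_pos _) (Real.exp_pos _) (Real.exp_pos _)
        (Real.exp_pos _).le ?_ ?_ (hf h) (hg h) hc (hfg h) hl
      · rw [Real.exp_le_one_iff]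
        linarith [infoGain_nonneg R δ n h]
      · rw [← Real.exp_add, ← Real.exp_add, ← Real.exp_nat_mul, logLik_add_add_logLik_sub]
        congr 1
        push_cast
        ring)
  rw [integral_const_mul, ← integral_historyLaw_eq π hR,
    integral_add' ((hf'.add hg').const_mul (l / 2))
      (((hint θ).add (hint (θ - δ))).const_mul (c / (2 * l))), integral_const_mul,
    integral_const_mul, integral_add' hf' hg', integral_add' (hint _) (hint _),
    ← integral_historyLaw_eq π hR, ← integral_historyLaw_eq π hR, hone, hone] at hmono
  refine hmono.trans (le_of_eq ?_)
  field_simp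
  ring

/-! ### The cube of block sequences and the information in one sign. -/

/-- The sign pattern, indexed by blocks and coordinates, that is `-1` exactly on `A`. -/
def signOf (A : Finset (ℕ × Fin d)) (j : ℕ) (i : Fin d) : ℝ := if (j, i) ∈ A then -1 else 1

lemma signOf_sq (A : Finset (ℕ × Fin d)) (j : ℕ) (i : Fin d) : signOf A j i ^ 2 = 1 := by
  unfold signOf; split_ifs <;> norm_num

lemma signOf_symmDiff_self (A : Finset (ℕ × Fin d)) (j : ℕ) (i : Fin d) :
    signOf (A ∆ {(j, i)}) j i = -signOf A j i := by
  unfold signOf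
  by_cases h : (j, i) ∈ A <;> simp [Finset.mem_symmDiff, h]

lemma signOf_symmDiff_of_ne (A : Finset (ℕ × Fin d)) {j j' : ℕ} {i i' : Fin d}
    (hne : (j', i') ≠ (j, i)) : signOf (A ∆ {(j, i)}) j' i' = signOf A j' i' := by
  unfold signOf
  simp only [Finset.mem_symmDiff, Finset.mem_singleton, hne, not_false_eq_true, and_true,
    false_and, or_false]

/-- The value of a block sequence of amplitude `a` on block `j`. -/
def cubePoint (a : ℝ) (A : Finset (ℕ × Fin d)) (j : ℕ) : Vec d :=
  WithLp.toLp 2 fun i => a * signOf A j i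

/-- The block sequence of amplitude `a` with signs given by `A`. -/
def cubeSeq (a : ℝ) (H : ℕ) (A : Finset (ℕ × Fin d)) (t : ℕ) : Vec d := cubePoint a A (t / H)

lemma inner_cubePoint (a : ℝ) (A : Finset (ℕ × Fin d)) (j : ℕ) (x : Vec d) :
    inner ℝ x (cubePoint a A j) = ∑ i, a * (x i * signOf A j i) := by
  simp only [cubePoint, PiLp.inner_apply, RCLike.inner_apply, conj_trivial]
  exact Finset.sum_congr rfl fun i _ => by ring

lemma norm_cubePoint {a : ℝ} (ha : 0 ≤ a) (A : Finset (ℕ × Fin d)) (j : ℕ) :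
    ‖cubePoint a A j‖ = a * √d := by
  rw [EuclideanSpace.norm_eq]
  simp only [cubePoint, Real.norm_eq_abs, sq_abs, mul_pow, signOf_sq]
  simp [Real.sqrt_mul' _ (sq_nonneg a), Real.sqrt_sq ha, mul_comm]

lemma inner_cubeSeq_flip (a : ℝ) (H : ℕ) (A : Finset (ℕ × Fin d)) (j : ℕ) (i : Fin d) (t : ℕ)
    (x : Vec d) :
    inner ℝ x ((cubeSeq a H (A ∆ {(j, i)}) - cubeSeq a H A) t) =
      if t / H = j then -(2 * a * signOf A j i * x i) else 0 := by
  rw [Pi.sub_apply, inner_sub_right, cubeSeq, cubeSeq, inner_cubePoint, inner_cubePoint,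
    ← Finset.sum_sub_distrib, Finset.sum_eq_single i]
  · split_ifs with h
    · rw [h, signOf_symmDiff_self]; ring
    · rw [signOf_symmDiff_of_ne _ (by simp [h])]; ring
  · intro i' _ hi'
    rw [signOf_symmDiff_of_ne _ (by simp [hi'])]; ring
  · simp

lemma infoGain_cubeSeq_flip (R a : ℝ) (H : ℕ) (A : Finset (ℕ × Fin d)) (j : ℕ) (i : Fin d) {n : ℕ}
    (h : History d n) :
    infoGain R (cubeSeq a H (A ∆ {(j, i)}) - cubeSeq a H A) n h =
      2 * a ^ 2 / R ^ 2 * ∑ t : Fin n with t.val / H = j, (h t).1 i ^ 2 := by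
  rw [infoGain, Finset.mul_sum, Finset.sum_filter]
  refine Finset.sum_congr rfl fun t _ => ?_
  rw [inner_cubeSeq_flip]
  split_ifs
  · rw [neg_sq, mul_pow, mul_pow, signOf_sq]; ring
  · simp

lemma card_block_le {H : ℕ} (hH : 1 ≤ H) (T j : ℕ) :
    (Finset.univ.filter fun t : Fin T => t.val / H = j).card ≤ H := by
  calc _ ≤ (Finset.Ico (j * H) (j * H + H)).card := by
        refine Finset.card_le_card_of_injOn (fun t => t.val) (fun t ht => ?_)
          fun s _ t _ hst => Fin.ext hst
        simp only [Finset.coe_filter, Finset.mem_univ, true_and, Set.mem_ofPred_eq] at ht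
        simp only [Finset.coe_Ico, Set.mem_Ico]
        have := (Nat.div_eq_iff (by omega : 0 < H)).1 ht
        constructor <;> grind
    _ = H := by simp

lemma sum_coord_sq (x : Vec d) : ∑ i, x i ^ 2 = ‖x‖ ^ 2 := by
  rw [EuclideanSpace.norm_eq, Real.sq_sqrt (by positivity)]; simp

/-- The `d` flips compete for the same energy: the squared coordinates of an action sum to at most
`L²`, and a block has at most `H` rounds. -/
lemma sum_infoGain_le {a : ℝ} {H : ℕ} (hH : 1 ≤ H) (hL : 0 < L) (hR : 0 < R)
    (ha : a ^ 2 ≤ d / (4 * H)) (A : Finset (ℕ × Fin d)) (j : ℕ) {n : ℕ} (h : History d n)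
    (hh : ∀ t, ‖(h t).1‖ ≤ L) :
    ∑ i, infoGain R (cubeSeq a H (A ∆ {(j, i)}) - cubeSeq a H A) n h ≤
      d * (L ^ 2 / (2 * R ^ 2)) := by
  simp only [infoGain_cubeSeq_flip]
  rw [← Finset.mul_sum, Finset.sum_comm]
  have h1 : ∑ t : Fin n with t.val / H = j, ∑ i, (h t).1 i ^ 2 ≤ H * L ^ 2 := by
    refine (Finset.sum_le_card_nsmul _ _ (L ^ 2) fun t _ => ?_).trans ?_
    · rw [sum_coord_sq]
      exact pow_le_pow_left₀ (norm_nonneg _) (hh t) 2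
    · rw [nsmul_eq_mul]
      gcongr
      exact card_block_le hH n j
  have hH' : (0 : ℝ) < H := by exact_mod_cast hH
  calc 2 * a ^ 2 / R ^ 2 * ∑ t : Fin n with t.val / H = j, ∑ i, (h t).1 i ^ 2
      ≤ 2 * (d / (4 * H)) / R ^ 2 * (H * L ^ 2) := by gcongr
    _ = d * (L ^ 2 / (2 * R ^ 2)) := by field_simp; ring

/-! ### Loss per coordinate and averaging over signs. -/

/-- Squared deviation, over block `j`, of coordinate `i` of the actions from the optimal one. -/
def coordLoss (L : ℝ) (H : ℕ) (A : Finset (ℕ × Fin d)) (j : ℕ) (i : Fin d) {n : ℕ}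
    (h : History d n) : ℝ :=
  ∑ t : Fin n with t.val / H = j, (L / √d - (h t).1 i * signOf A j i) ^ 2

lemma coordLoss_nonneg (L : ℝ) (H : ℕ) (A : Finset (ℕ × Fin d)) (j : ℕ) (i : Fin d) {n : ℕ}
    (h : History d n) : 0 ≤ coordLoss L H A j i h :=
  Finset.sum_nonneg fun _ _ => sq_nonneg _

lemma integrable_coordLoss (π : Policy d (ballSets d L)) (R : ℝ) (θ : ℕ → Vec d) (H : ℕ)
    (A : Finset (ℕ × Fin d)) (j : ℕ) (i : Fin d) (n : ℕ) :
    Integrable (coordLoss L H A j i) (historyLaw π (noise R) θ n) := by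
  refine integrable_historyLaw π R θ (by unfold coordLoss; fun_prop)
    (M := ∑ t : Fin n with t.val / H = j, (|L / √d| + L) ^ 2) fun h hh => ?_
  rw [abs_of_nonneg (coordLoss_nonneg ..)]
  refine Finset.sum_le_sum fun t _ => ?_
  rw [← sq_abs]
  refine pow_le_pow_left₀ (abs_nonneg _) ((abs_sub _ _).trans ?_) 2
  have h1 : |signOf A j i| = 1 := by
    rw [← sq_eq_sq₀ (abs_nonneg _) zero_le_one, sq_abs, signOf_sq, one_pow]
  rw [abs_mul, h1, mul_one]
  have : |(h t).1 i| ≤ ‖(h t).1‖ := PiLp.norm_apply_le (h t).1 i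
  linarith [hh t]

/-- Per round, `(u - v)² + (u + v)² ≥ 2u²` with `u = L/√d`: no action is good for both signs. -/
lemma le_coordLoss_add_coordLoss_flip (hd : 1 ≤ d) (H : ℕ) (A : Finset (ℕ × Fin d)) (j : ℕ)
    (i : Fin d) {n : ℕ} (h : History d n) :
    (Finset.univ.filter fun t : Fin n => t.val / H = j).card * (2 * L ^ 2 / d) ≤
      coordLoss L H A j i h + coordLoss L H (A ∆ {(j, i)}) j i h := by
  rw [coordLoss, coordLoss, ← Finset.sum_add_distrib, ← nsmul_eq_mul]
  refine Finset.card_nsmul_le_sum _ _ _ fun t _ => ?_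
  have hd' : (0 : ℝ) < d := by exact_mod_cast hd
  rw [signOf_symmDiff_self]
  have h1 : (L / √d) ^ 2 = L ^ 2 / d := by rw [div_pow, Real.sq_sqrt hd'.le]
  have h2 : 2 * L ^ 2 / d = 2 * (L / √d) ^ 2 := by rw [h1]; ring
  nlinarith [sq_nonneg ((h t).1 i * signOf A j i)]

lemma card_mul_le_sum_integral_coordLoss (hd : 1 ≤ d) (hL : 0 < L) (hR : 0 < R) {a : ℝ} {H : ℕ}
    (hH : 1 ≤ H) (ha : a ^ 2 ≤ d / (4 * H)) (π : Policy d (ballSets d L)) (T : ℕ)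
    (A : Finset (ℕ × Fin d)) (j : ℕ) :
    (Finset.univ.filter fun t : Fin T => t.val / H = j).card
        * (L ^ 2 * Real.exp (-(L ^ 2 / R ^ 2))) ≤
      ∑ i, (∫ h, coordLoss L H A j i h ∂(historyLaw π (noise R) (cubeSeq a H A) T) +
        ∫ h, coordLoss L H (A ∆ {(j, i)}) j i h
          ∂(historyLaw π (noise R) (cubeSeq a H (A ∆ {(j, i)})) T)) := by
  set N : ℝ := ((Finset.univ.filter fun t : Fin T => t.val / H = j).card : ℝ) with hN
  set K : ℝ := L ^ 2 / (2 * R ^ 2) with hK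
  set c : ℝ := N * (2 * L ^ 2 / d) with hc
  have hc0 : 0 ≤ c := by positivity
  have hd' : (0 : ℝ) < d := by exact_mod_cast hd
  set V : Fin d → History d T → ℝ := fun i =>
    infoGain R (cubeSeq a H (A ∆ {(j, i)}) - cubeSeq a H A) T with hV
  have hVm : ∀ i, Measurable (V i) := fun i => measurable_infoGain ..
  have hEi : ∀ i, Integrable (fun h => Real.exp (-V i h))
      (historyLaw π (noise R) (cubeSeq a H A) T) := fun i => by
    have := hVm i
    refine integrable_historyLaw π R _ (by fun_prop) (M := 1) fun h _ => ?_
    rw [abs_of_pos (Real.exp_pos _), Real.exp_le_one_iff]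
    linarith [infoGain_nonneg R (cubeSeq a H (A ∆ {(j, i)}) - cubeSeq a H A) T h]
  have hE : d * Real.exp (-K) ≤
      ∑ i, ∫ h, Real.exp (-V i h) ∂(historyLaw π (noise R) (cubeSeq a H A) T) := by
    rw [← integral_finsetSum _ fun i _ => hEi i]
    have : ∫ _, (d * Real.exp (-K)) ∂(historyLaw π (noise R) (cubeSeq a H A) T) =
        d * Real.exp (-K) := by simp
    rw [← this]
    refine integral_mono_ae (integrable_const _) (integrable_finsetSum _ fun i _ => hEi i) ?_
    filter_upwards [ae_norm_action_le π R (cubeSeq a H A) T] with h hh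
    have h1 := sum_infoGain_le hH hL hR ha A j h hh
    -- Tangent line of `v ↦ exp (-v)` at `K`. Since the `V i` sum to at most `d K`, the linear terms
    -- have nonnegative sum.
    have h2 : ∀ i, Real.exp (-K) * (1 + (K - V i h)) ≤ Real.exp (-V i h) := fun i => by
      have := Real.add_one_le_exp (K - V i h)
      calc Real.exp (-K) * (1 + (K - V i h)) ≤ Real.exp (-K) * Real.exp (K - V i h) := by
            gcongr; linarith
        _ = Real.exp (-V i h) := by rw [← Real.exp_add]; congr 1; ring
    refine le_trans ?_ (Finset.sum_le_sum fun i _ => h2 i)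
    rw [← Finset.mul_sum, Finset.sum_add_distrib, Finset.sum_sub_distrib]
    simp only [Finset.sum_const, Finset.card_univ, Fintype.card_fin, nsmul_eq_mul, mul_one]
    have : 0 ≤ Real.exp (-K) * (d * K - ∑ i, V i h) :=
      mul_nonneg (Real.exp_pos _).le (by simpa [hV] using h1)
    linarith
  have hpt : ∀ i, c * ∫ h, Real.exp (-V i h) ∂(historyLaw π (noise R) (cubeSeq a H A) T) ≤
      Real.exp K * (∫ h, coordLoss L H A j i h ∂(historyLaw π (noise R) (cubeSeq a H A) T) +
        ∫ h, coordLoss L H (A ∆ {(j, i)}) j i h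
          ∂(historyLaw π (noise R) (cubeSeq a H (A ∆ {(j, i)})) T)) +
        c * Real.exp (-K) / 2 := fun i => by
    -- With `l = 2 exp K` the error `c / l` is half of the main term `c exp (-K)` supplied by `hE`.
    have h1 := mul_integral_exp_neg_infoGain_le π hR (cubeSeq a H A)
      (cubeSeq a H (A ∆ {(j, i)}) - cubeSeq a H A) (n := T)
      (f := coordLoss L H A j i) (g := coordLoss L H (A ∆ {(j, i)}) j i)
      (coordLoss_nonneg L H A j i) (coordLoss_nonneg L H _ j i)
      (integrable_coordLoss π R _ H A j i T) (integrable_coordLoss π R _ H _ j i T) hc0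
      (le_coordLoss_add_coordLoss_flip hd H A j i) (l := 2 * Real.exp K) (by positivity)
    rw [add_sub_cancel] at h1
    refine h1.trans (le_of_eq ?_)
    rw [Real.exp_neg]
    field_simp
  have hsum := Finset.sum_le_sum fun i (_ : i ∈ Finset.univ) => hpt i
  rw [← Finset.mul_sum, Finset.sum_add_distrib, ← Finset.mul_sum] at hsum
  simp only [Finset.sum_const, Finset.card_univ, Fintype.card_fin, nsmul_eq_mul] at hsum
  have h3 := (mul_le_mul_of_nonneg_left hE hc0).trans hsum
  have h4 : d * c = 2 * (N * L ^ 2) := by rw [hc]; field_simp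
  have hKK : Real.exp (-(L ^ 2 / R ^ 2)) = Real.exp (-K) * Real.exp (-K) := by
    rw [← Real.exp_add]; congr 1; rw [hK]; field_simp; ring
  have h5 : Real.exp (-K) * Real.exp K = 1 := by rw [← Real.exp_add]; simp
  set W := ∑ i, (∫ h, coordLoss L H A j i h ∂(historyLaw π (noise R) (cubeSeq a H A) T) +
        ∫ h, coordLoss L H (A ∆ {(j, i)}) j i h
          ∂(historyLaw π (noise R) (cubeSeq a H (A ∆ {(j, i)})) T)) with hW
  have h6 : N * L ^ 2 * Real.exp (-K) ≤ Real.exp K * W := by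
    linear_combination h3 - Real.exp (-K) / 2 * h4
  have h7 := mul_le_mul_of_nonneg_left h6 (Real.exp_pos (-K)).le
  rw [hKK]
  linear_combination h7 + W * h5

/-- Flipping one sign permutes the patterns, so on average both terms of the two-point bound are
equal; some pattern does at least as badly as the average. -/
lemma exists_le_sum_integral_coordLoss (hd : 1 ≤ d) (hL : 0 < L) (hR : 0 < R) {a : ℝ} {H : ℕ}
    (hH : 1 ≤ H) (ha : a ^ 2 ≤ d / (4 * H)) (π : Policy d (ballSets d L)) (T : ℕ) :
    ∃ A : Finset (ℕ × Fin d), T * (L ^ 2 * Real.exp (-(L ^ 2 / R ^ 2))) / 2 ≤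
      ∑ j ∈ Finset.range T, ∑ i,
        ∫ h, coordLoss L H A j i h ∂(historyLaw π (noise R) (cubeSeq a H A) T) := by
  -- Block indices below `T` cover all rounds, since `t / H ≤ t < T`.
  set P := (Finset.range T ×ˢ (Finset.univ : Finset (Fin d))).powerset with hP
  set E : Finset (ℕ × Fin d) → ℕ → Fin d → ℝ := fun A j i =>
    ∫ h, coordLoss L H A j i h ∂(historyLaw π (noise R) (cubeSeq a H A) T) with hE
  set C : ℝ := L ^ 2 * Real.exp (-(L ^ 2 / R ^ 2)) with hC
  have hflip : ∀ j ∈ Finset.range T, ∀ i : Fin d,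
      ∑ A ∈ P, E (A ∆ {(j, i)}) j i = ∑ A ∈ P, E A j i := fun j hj i => by
    have hmem : ∀ A ∈ P, A ∆ {(j, i)} ∈ P := fun A hA => by
      rw [hP, Finset.mem_powerset] at hA ⊢
      intro x hx
      rw [Finset.mem_symmDiff, Finset.mem_singleton] at hx
      rcases hx with ⟨hx, -⟩ | ⟨rfl, -⟩
      · exact hA hx
      · simpa using hj
    exact Finset.sum_nbij' (fun A => A ∆ {(j, i)}) (fun A => A ∆ {(j, i)}) hmem hmem
      (fun A _ => symmDiff_symmDiff_cancel_right _ _)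
      (fun A _ => symmDiff_symmDiff_cancel_right _ _) fun A _ => rfl
  have hcard : ∑ j ∈ Finset.range T,
      ((Finset.univ.filter fun t : Fin T => t.val / H = j).card : ℝ) = T := by
    have := Finset.card_eq_sum_card_fiberwise (s := (Finset.univ : Finset (Fin T)))
      (f := fun t : Fin T => t.val / H) (t := Finset.range T) (fun t _ => by
        simpa using (Nat.div_le_self _ _).trans_lt t.2)
    rw [Finset.card_univ, Fintype.card_fin] at this
    exact_mod_cast this.symm
  have hA : ∀ A ∈ P, T * C ≤
      ∑ j ∈ Finset.range T, ∑ i, (E A j i + E (A ∆ {(j, i)}) j i) := fun A _ => by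
    rw [← hcard, Finset.sum_mul]
    exact Finset.sum_le_sum fun j _ => card_mul_le_sum_integral_coordLoss hd hL hR hH ha π T A j
  have htot : ∑ A ∈ P, (T * C / 2) ≤ ∑ A ∈ P, ∑ j ∈ Finset.range T, ∑ i, E A j i := by
    have h1 := Finset.sum_le_sum hA
    have h2 : ∑ A ∈ P, ∑ j ∈ Finset.range T, ∑ i, (E A j i + E (A ∆ {(j, i)}) j i) =
        2 * ∑ A ∈ P, ∑ j ∈ Finset.range T, ∑ i, E A j i := by
      simp only [Finset.sum_add_distrib]
      rw [two_mul]
      congr 1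
      rw [Finset.sum_comm, Finset.sum_comm (s := P)]
      refine Finset.sum_congr rfl fun j hj => ?_
      rw [Finset.sum_comm, Finset.sum_comm (s := P)]
      exact Finset.sum_congr rfl fun i _ => hflip j hj i
    rw [h2] at h1
    rw [← Finset.sum_div]
    linarith
  obtain ⟨A, -, h⟩ := Finset.exists_le_of_sum_le ⟨∅, by simp [hP]⟩ htot
  exact ⟨A, h⟩

/-! ### From coordinate losses to regret. -/

/-- Expanding the square and using `‖x‖ ≤ L` bounds the squared distance to the optimal action by a
multiple of the gap in reward. -/
lemma le_instantRegret (hd : 1 ≤ d) (hL : 0 < L) {a : ℝ} (ha : 0 ≤ a) (A : Finset (ℕ × Fin d))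
    (j t : ℕ) {x : Vec d} (hx : ‖x‖ ≤ L) :
    a * √d / (2 * L) * ∑ i, (L / √d - x i * signOf A j i) ^ 2 ≤
      (⨆ y : ballSets d L t, inner ℝ (y : Vec d) (cubePoint a A j))
        - inner ℝ x (cubePoint a A j) := by
  have hd' : (0 : ℝ) < d := by exact_mod_cast hd
  have hs : √(d : ℝ) * √d = d := Real.mul_self_sqrt hd'.le
  have hs0 : 0 < √(d : ℝ) := Real.sqrt_pos.2 hd'
  have hsup : L * (a * √d) ≤ ⨆ y : ballSets d L t, inner ℝ (y : Vec d) (cubePoint a A j) := by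
    -- The optimal action is the parameter rescaled to norm `L`.
    have hz : cubePoint (L / √d) A j ∈ ballSets d L t := by
      simp only [ballSets, mem_closedBall_zero_iff]
      rw [norm_cubePoint (by positivity), div_mul_cancel₀ _ hs0.ne']
    have hb : BddAbove (Set.range fun y : ballSets d L t =>
        inner ℝ (y : Vec d) (cubePoint a A j)) := by
      refine ⟨L * ‖cubePoint a A j‖, ?_⟩
      rintro _ ⟨y, rfl⟩
      have hy : ‖(y : Vec d)‖ ≤ L := by simpa [ballSets] using y.2
      exact (real_inner_le_norm _ _).trans (by gcongr)
    refine le_trans (le_of_eq ?_) (le_ciSup hb ⟨_, hz⟩)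
    show _ = inner ℝ (cubePoint (L / √d) A j) (cubePoint a A j)
    rw [inner_cubePoint]
    simp only [cubePoint, mul_assoc, ← sq, signOf_sq]
    simp only [mul_one, Finset.sum_const, Finset.card_univ, Fintype.card_fin, nsmul_eq_mul]
    field_simp
    rw [sq, hs]
  have hexp : ∑ i, (L / √d - x i * signOf A j i) ^ 2 ≤
      2 * L ^ 2 - 2 * (L / √d) * ∑ i, x i * signOf A j i := by
    have h1 : ∀ i, (L / √d - x i * signOf A j i) ^ 2 =
        (L / √d) ^ 2 - 2 * (L / √d) * (x i * signOf A j i) + x i ^ 2 := fun i => by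
      linear_combination x i ^ 2 * signOf_sq A j i
    simp only [h1, Finset.sum_add_distrib, Finset.sum_sub_distrib, ← Finset.mul_sum]
    rw [sum_coord_sq]
    simp only [Finset.sum_const, Finset.card_univ, Fintype.card_fin, nsmul_eq_mul]
    rw [div_pow, sq (√(d : ℝ)), hs]
    have h2 : (d : ℝ) * (L ^ 2 / d) = L ^ 2 := by field_simp
    have h3 := pow_le_pow_left₀ (norm_nonneg x) hx 2
    linarith
  rw [inner_cubePoint, ← Finset.mul_sum]
  calc _ ≤ a * √d / (2 * L) * (2 * L ^ 2 - 2 * (L / √d) * ∑ i, x i * signOf A j i) := by gcongr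
    _ = L * (a * √d) - a * ∑ i, x i * signOf A j i := by field_simp
    _ ≤ _ := by linarith

/-- Among the block sequences of amplitude `a ≤ √(d / (4 H))`, one forces regret of order
`a √d T`. -/
lemma exists_cubeSeq_le_expectedRegret (hd : 1 ≤ d) (hL : 0 < L) (hR : 0 < R) {a : ℝ} (ha0 : 0 ≤ a)
    {H : ℕ} (hH : 1 ≤ H) (ha : a ^ 2 ≤ d / (4 * H)) (π : Policy d (ballSets d L)) (T : ℕ) :
    ∃ A : Finset (ℕ × Fin d),
      L * Real.exp (-(L ^ 2 / R ^ 2)) / 4 * (a * √d * T) ≤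
        expectedRegret π (noise R) T (cubeSeq a H A) := by
  obtain ⟨A, hA⟩ := exists_le_sum_integral_coordLoss hd hL hR hH ha π T
  refine ⟨A, ?_⟩
  set μ := historyLaw π (noise R) (cubeSeq a H A) T with hμ
  have hIi : Integrable (fun h => ∑ j ∈ Finset.range T, ∑ i, coordLoss L H A j i h) μ :=
    integrable_finsetSum _ fun j _ => integrable_finsetSum _ fun i _ =>
      integrable_coordLoss π R _ H A j i T
  have hswap : ∀ h : History d T, ∑ j ∈ Finset.range T, ∑ i, coordLoss L H A j i h =
      ∑ t : Fin T, ∑ i, (L / √d - (h t).1 i * signOf A (t.val / H) i) ^ 2 := fun h => by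
    have hmaps : ∀ t ∈ (Finset.univ : Finset (Fin T)), t.val / H ∈ Finset.range T := fun t _ => by
      simpa using (Nat.div_le_self _ _).trans_lt t.2
    rw [← Finset.sum_fiberwise_of_maps_to hmaps]
    refine Finset.sum_congr rfl fun j _ => ?_
    simp only [coordLoss]
    rw [Finset.sum_comm]
    refine Finset.sum_congr rfl fun t ht => ?_
    rw [(Finset.mem_filter.1 ht).2]
  have hle : a * √d / (2 * L) * ∫ h, ∑ j ∈ Finset.range T, ∑ i, coordLoss L H A j i h ∂μ ≤
      expectedRegret π (noise R) T (cubeSeq a H A) := by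
    rw [← integral_const_mul, expectedRegret]
    refine integral_mono_ae (hIi.const_mul _) ?_ ?_
    · refine integrable_historyLaw π R _ (by fun_prop)
        (M := ∑ t : Fin T, (|⨆ x : ballSets d L t, inner ℝ (x : Vec d) (cubeSeq a H A t)| +
          L * ‖cubeSeq a H A t‖)) fun h hh => ?_
      refine (Finset.abs_sum_le_sum_abs _ _).trans (Finset.sum_le_sum fun t _ => ?_)
      refine (abs_sub _ _).trans ?_
      gcongr
      exact (abs_real_inner_le_norm _ _).trans (by gcongr; exact hh t)
    · filter_upwards [ae_norm_action_le π R (cubeSeq a H A) T] with h hh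
      rw [hswap h, Finset.mul_sum]
      exact Finset.sum_le_sum fun t _ => le_instantRegret hd hL ha0 A _ t (hh t)
  rw [integral_finsetSum _ fun j _ => integrable_finsetSum _ fun i _ =>
      integrable_coordLoss π R _ H A j i T] at hle
  simp only [integral_finsetSum _ fun i _ => integrable_coordLoss π R _ H A _ i T] at hle
  refine le_trans ?_ hle
  calc _ = a * √d / (2 * L) * (T * (L ^ 2 * Real.exp (-(L ^ 2 / R ^ 2))) / 2) := by
        field_simp; ring
    _ ≤ _ := by gcongr

/-! ### Variation and admissibility of block sequences. -/

lemma variation_cubeSeq_le {a : ℝ} (ha : 0 ≤ a) {H : ℕ} (hH : 1 ≤ H) (A : Finset (ℕ × Fin d))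
    (T : ℕ) : variation T (cubeSeq a H A) ≤ 2 * (a * √d) * (T / H) := by
  have key : ∀ n : ℕ, ∑ t ∈ Finset.range n, ‖cubeSeq a H A (t + 1) - cubeSeq a H A t‖ ≤
      2 * (a * √d) * (n / H : ℕ) := fun n => by
    induction n with
    | zero => simp
    | succ n ih =>
      -- A jump from `n` to `n + 1` is possible only if `H ∣ n + 1`, exactly when `n / H` increases.
      rw [Finset.sum_range_succ, Nat.succ_div]
      split_ifs with h
      · have h1 := norm_sub_le (cubeSeq a H A (n + 1)) (cubeSeq a H A n)
        simp only [cubeSeq, norm_cubePoint ha] at h1 ih ⊢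
        push_cast
        linarith
      · have h1 : cubeSeq a H A (n + 1) = cubeSeq a H A n := by
          simp [cubeSeq, Nat.succ_div, h]
        simpa [h1] using ih
  refine (key (T - 1)).trans ?_
  have h2 : (((T - 1) / H : ℕ) : ℝ) ≤ T / H := by
    refine Nat.cast_div_le.trans ?_
    gcongr
    exact Nat.sub_le _ _
  gcongr

lemma cubeSeq_mem_admissible {a S B : ℝ} (ha : 0 ≤ a) {H : ℕ} (hH : 1 ≤ H)
    (A : Finset (ℕ × Fin d)) {T : ℕ} (hS : a * √d ≤ S) (hL : L * (a * √d) ≤ 1)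
    (hB : 2 * (a * √d) * (T / H) ≤ B) :
    cubeSeq a H A ∈ admissible (ballSets d L) S T B := by
  refine ⟨fun t _ => ⟨by rwa [cubeSeq, norm_cubePoint ha], fun x hx => ?_⟩,
    (variation_cubeSeq_le ha hH A T).trans hB⟩
  have hx' : ‖x‖ ≤ L := by simpa [ballSets] using hx
  refine (abs_real_inner_le_norm _ _).trans (le_trans ?_ hL)
  rw [cubeSeq, norm_cubePoint ha]
  gcongr

lemma cubeSeq_sqrt_mem_blockSequences (H T : ℕ) (A : Finset (ℕ × Fin d)) :
    cubeSeq √((d : ℝ) / (4 * H)) H A ∈ blockSequences d T H := by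
  refine ⟨cubePoint _ A, fun j i => ?_, fun t _ => rfl⟩
  simp only [cubePoint, signOf]
  split_ifs <;> simp

/-! ### Block length against rate. -/

lemma rate_nonneg (d T : ℕ) {B : ℝ} (hB : 0 < B) : 0 ≤ rate d T B := by
  unfold rate; positivity

lemma rate_mul_rpow (d T : ℕ) {B : ℝ} (hB : 0 < B) :
    rate d T B * ((d : ℝ) * T / B) ^ (1 / 3 : ℝ) = d * T := by
  have h3 : ∀ x : ℝ, 0 ≤ x → x ^ (2 / 3 : ℝ) * x ^ (1 / 3 : ℝ) = x := fun x hx => by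
    rw [← Real.rpow_add_of_nonneg hx (by norm_num) (by norm_num)]; norm_num
  have hB' : 0 < B ^ (1 / 3 : ℝ) := by positivity
  rw [rate, Real.div_rpow (by positivity) hB.le, Real.mul_rpow (by positivity) (by positivity)]
  field_simp
  calc _ = ((d : ℝ) ^ (2 / 3 : ℝ) * (d : ℝ) ^ (1 / 3 : ℝ)) *
        ((T : ℝ) ^ (2 / 3 : ℝ) * (T : ℝ) ^ (1 / 3 : ℝ)) := by ring
    _ = _ := by rw [h3 _ (by positivity), h3 _ (by positivity)]

lemma rate_le_of_sq_mul_le {d T : ℕ} {B : ℝ} (hB : 0 < B) (h : (d : ℝ) ^ 2 * B ≤ T) :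
    rate d T B ≤ T := by
  have h1 : (d : ℝ) ^ (2 / 3 : ℝ) * B ^ (1 / 3 : ℝ) = ((d : ℝ) ^ 2 * B) ^ (1 / 3 : ℝ) := by
    rw [Real.mul_rpow (by positivity) hB.le, ← Real.rpow_natCast, ← Real.rpow_mul (by positivity)]
    norm_num
  rw [rate, h1]
  calc _ ≤ (T : ℝ) ^ (1 / 3 : ℝ) * (T : ℝ) ^ (2 / 3 : ℝ) := by gcongr
    _ = T := by
      rw [← Real.rpow_add_of_nonneg (by positivity) (by norm_num) (by norm_num)]; norm_num

lemma one_le_blockLength {d T : ℕ} (hd : 1 ≤ d) (hT : 1 ≤ T) {B : ℝ} (hB : 0 < B) :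
    1 ≤ blockLength d T B := by
  have hd' : (0 : ℝ) < d := by exact_mod_cast hd
  have hT' : (0 : ℝ) < T := by exact_mod_cast hT
  exact Nat.one_le_iff_ne_zero.2 (Nat.ceil_pos.2 (by positivity)).ne'

lemma rpow_le_sqrt_blockLength (d T : ℕ) {B : ℝ} (hB : 0 < B) :
    ((d : ℝ) * T / B) ^ (1 / 3 : ℝ) ≤ √(blockLength d T B) := by
  refine Real.le_sqrt_of_sq_le (le_trans (le_of_eq ?_) (Nat.le_ceil _))
  rw [← Real.rpow_natCast, ← Real.rpow_mul (by positivity)]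
  norm_num

/-- This is where the exponent `2/3` comes from: it gives `√H ^ 3 ≥ dT/B`, and rounding `H` up only
helps. -/
lemma div_sqrt_blockLength_mul_le {d T : ℕ} (hd : 1 ≤ d) (hT : 1 ≤ T) {B : ℝ} (hB : 0 < B) :
    (d : ℝ) / √(blockLength d T B) * (T / blockLength d T B) ≤ B := by
  have hH : (0 : ℝ) < blockLength d T B := by exact_mod_cast one_le_blockLength hd hT hB
  have hs := Real.sqrt_pos.2 hH
  have h1 : (d : ℝ) * T / B ≤ √(blockLength d T B) ^ 3 := by
    refine le_trans (le_of_eq ?_)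
      (pow_le_pow_left₀ (by positivity) (rpow_le_sqrt_blockLength d T hB) 3)
    rw [← Real.rpow_natCast, ← Real.rpow_mul (by positivity)]
    norm_num
  have h2 : √(blockLength d T B : ℝ) ^ 3 = √(blockLength d T B) * blockLength d T B := by
    rw [pow_succ, Real.sq_sqrt hH.le, mul_comm]
  rw [div_mul_div_comm, div_le_iff₀ (by positivity), ← h2, mul_comm B]
  exact (div_le_iff₀ hB).1 h1

/-- As `dT/B ≥ 1`, rounding up still leaves `√H ≤ 2 (dT/B)^(1/3)`; the other factor `2` is in the
amplitude. -/
lemma rate_div_four_le {d T : ℕ} (hd : 1 ≤ d) (hT : 1 ≤ T) {B : ℝ} (hB : 0 < B)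
    (hBd : B ≤ d * T) : rate d T B / 4 ≤ (d : ℝ) / (2 * √(blockLength d T B)) * T := by
  have hH : (0 : ℝ) < blockLength d T B := by exact_mod_cast one_le_blockLength hd hT hB
  have hs := Real.sqrt_pos.2 hH
  have hq : 1 ≤ (d : ℝ) * T / B := (one_le_div hB).2 hBd
  have h1 : √(blockLength d T B : ℝ) ≤ 2 * ((d : ℝ) * T / B) ^ (1 / 3 : ℝ) := by
    refine Real.sqrt_le_iff.2 ⟨by positivity, ?_⟩
    have h2 : (blockLength d T B : ℝ) ≤ ((d : ℝ) * T / B) ^ (2 / 3 : ℝ) + 1 :=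
      (Nat.ceil_lt_add_one (by positivity)).le
    have h3 : 1 ≤ ((d : ℝ) * T / B) ^ (2 / 3 : ℝ) := Real.one_le_rpow hq (by norm_num)
    have h4 : (((d : ℝ) * T / B) ^ (1 / 3 : ℝ)) ^ 2 = ((d : ℝ) * T / B) ^ (2 / 3 : ℝ) := by
      rw [← Real.rpow_natCast, ← Real.rpow_mul (by positivity)]
      norm_num
    rw [mul_pow, h4]
    linarith
  rw [div_mul_eq_mul_div, le_div_iff₀ (by positivity), ← rate_mul_rpow d T hB]
  have := mul_le_mul_of_nonneg_left h1 (rate_nonneg d T hB)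
  linarith

lemma blockLength_eq_one {d T : ℕ} (hd : 1 ≤ d) (hT : 1 ≤ T) {B : ℝ} (hB : 0 < B)
    (hBd : d * T ≤ B) : blockLength d T B = 1 := by
  refine le_antisymm (Nat.ceil_le.2 ?_) (one_le_blockLength hd hT hB)
  simpa using Real.rpow_le_one (by positivity) ((div_le_one hB).2 hBd) (by norm_num)

lemma min_mul_min_le {d T : ℕ} (hd : 1 ≤ d) (hT : 1 ≤ T) {B : ℝ} (hB : 0 < B) {s : ℝ}
    (hs : 0 ≤ s) : min s (1 / 4) * min (T : ℝ) (rate d T B) ≤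
      min s ((d : ℝ) / (2 * √(blockLength d T B))) * T := by
  have hr := rate_nonneg d T hB
  rw [min_mul_of_nonneg _ _ (Nat.cast_nonneg T)]
  refine le_min ?_ ?_
  · gcongr
    · exact min_le_left _ _
    · exact min_le_left _ _
  · rcases le_total B (d * T) with h | h
    · refine le_trans ?_ (rate_div_four_le hd hT hB h)
      calc _ ≤ 1 / 4 * rate d T B := by
            gcongr
            · exact min_le_right _ _
            · exact min_le_right _ _
        _ = _ := by ring
    -- Blocks now have length one, and `d / 2 ≥ 1 / 4` suffices to compare with `T`.
    · have hd' : (1 : ℝ) ≤ d := by exact_mod_cast hd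
      rw [blockLength_eq_one hd hT hB h]
      calc _ ≤ 1 / 4 * (T : ℝ) := by
            gcongr
            · exact min_le_right _ _
            · exact min_le_left _ _
        _ ≤ _ := by
          gcongr
          simp only [Nat.cast_one, Real.sqrt_one]
          linarith

lemma eventually_rate_le {d : ℕ} {B : ℕ → ℝ} {ρ : ℝ} (hB : ∀ T, 0 < B T) (hρ : ρ < 1)
    (h : B =O[atTop] fun T : ℕ => (T : ℝ) ^ ρ) : ∀ᶠ T : ℕ in atTop, rate d T (B T) ≤ T := by
  have h0 : (fun x : ℝ => x ^ ρ) =o[atTop] fun x : ℝ => x := by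
    refine (isLittleO_iff_tendsto' ?_).2 ((tendsto_rpow_neg_atTop (sub_pos.2 hρ)).congr' ?_)
    · filter_upwards [eventually_gt_atTop 0] with x hx h using absurd h hx.ne'
    · filter_upwards [eventually_gt_atTop 0] with x hx
      rw [neg_sub, Real.rpow_sub_one hx.ne']
  have h1 : (fun T : ℕ => (T : ℝ) ^ ρ) =o[atTop] fun T : ℕ => (T : ℝ) :=
    h0.comp_tendsto tendsto_natCast_atTop_atTop
  have h2 := ((h.trans_isLittleO h1).const_mul_left ((d : ℝ) ^ 2)).bound one_pos
  filter_upwards [h2] with T hT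
  refine rate_le_of_sq_mul_le (hB T) ?_
  have := (le_abs_self _).trans hT
  simpa using this

/-- Below a threshold there are finitely many horizons; dividing by one plus the sum of their rates
absorbs them, because `T ≥ 1`. -/
lemma exists_pos_mul_rate_le {d : ℕ} {B : ℕ → ℝ} (hB : ∀ T, 0 < B T)
    (h : ∀ᶠ T : ℕ in atTop, rate d T (B T) ≤ T) :
    ∃ k : ℝ, 0 < k ∧ ∀ T : ℕ, 1 ≤ T → k * rate d T (B T) ≤ min (T : ℝ) (rate d T (B T)) := by
  obtain ⟨N, hN⟩ := eventually_atTop.1 h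
  have hr := fun T => rate_nonneg d T (hB T)
  set M : ℝ := 1 + ∑ T ∈ Finset.range N, rate d T (B T) with hM
  have hM1 : 1 ≤ M := by
    have := Finset.sum_nonneg fun T (_ : T ∈ Finset.range N) => hr T
    linarith
  have hM0 : 0 < M := by linarith
  refine ⟨M⁻¹, by positivity, fun T hT => le_min ?_ ?_⟩
  · rw [inv_mul_le_iff₀ hM0]
    have hT' : (1 : ℝ) ≤ T := by exact_mod_cast hT
    rcases lt_or_ge T N with hTN | hTN
    · have := Finset.single_le_sum (fun t _ => hr t) (Finset.mem_range.2 hTN)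
      nlinarith
    · nlinarith [hN T hTN]
  · rw [inv_mul_le_iff₀ hM0]
    nlinarith [hr T]

/-! ### Lower bounds on the dynamic regret. -/

lemma le_dynamicRegret (hd : 1 ≤ d) (hL : 0 < L) (hR : 0 < R) {a : ℝ} (ha0 : 0 ≤ a)
    {H : ℕ} (hH : 1 ≤ H) (ha : a ^ 2 ≤ d / (4 * H)) (π : Policy d (ballSets d L)) (T : ℕ)
    {C : Set (ℕ → Vec d)} (hC : ∀ A, cubeSeq a H A ∈ C) {r : ℝ}
    (hr : r ≤ L * Real.exp (-(L ^ 2 / R ^ 2)) / 4 * (a * √d * T)) :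
    (r : EReal) ≤ dynamicRegret π (noise R) T C := by
  obtain ⟨A, hA⟩ := exists_cubeSeq_le_expectedRegret hd hL hR ha0 hH ha π T
  exact (EReal.coe_le_coe_iff.2 (hr.trans hA)).trans
    (le_iSup₂ (f := fun θ (_ : θ ∈ C) => (expectedRegret π (noise R) T θ : EReal)) _ (hC A))

lemma le_dynamicRegret_admissible (hd : 1 ≤ d) (hL : 0 < L) (hR : 0 < R) {S : ℝ} (hS : 0 < S)
    {T : ℕ} (hT : 1 ≤ T) {B : ℝ} (hB : 0 < B) (π : Policy d (ballSets d L)) :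
    ((L * Real.exp (-(L ^ 2 / R ^ 2)) / 4 * min (min S (1 / L)) (1 / 4)
        * min (T : ℝ) (rate d T B) : ℝ) : EReal) ≤
      dynamicRegret π (noise R) T (admissible (ballSets d L) S T B) := by
  have hd' : (0 : ℝ) < d := by exact_mod_cast hd
  have hs : 0 ≤ min S (1 / L) := by positivity
  have hH := one_le_blockLength hd hT hB
  have hH' : (0 : ℝ) < blockLength d T B := by exact_mod_cast hH
  -- `α` is the norm of the parameter, capped by `S` and by `1 / L`; the amplitude per coordinate is
  -- `α / √d`.
  set α : ℝ := min (min S (1 / L)) ((d : ℝ) / (2 * √(blockLength d T B))) with hα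
  have hα0 : 0 ≤ α := by positivity
  have hα1 : α ≤ d / (2 * √(blockLength d T B)) := min_le_right _ _
  have hmul : α / √d * √d = α := div_mul_cancel₀ _ (Real.sqrt_pos.2 hd').ne'
  refine le_dynamicRegret hd hL hR (a := α / √d) (by positivity) hH ?_ π T (fun A =>
    cubeSeq_mem_admissible (by positivity) hH A ?_ ?_ ?_) ?_
  · rw [div_pow, Real.sq_sqrt hd'.le, div_le_iff₀ hd']
    refine (pow_le_pow_left₀ hα0 hα1 2).trans (le_of_eq ?_)
    rw [div_pow, mul_pow, Real.sq_sqrt hH'.le]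
    field_simp
    norm_num
  · rw [hmul]
    exact (min_le_left _ _).trans (min_le_left _ _)
  · rw [hmul, mul_comm, ← le_div_iff₀ hL]
    exact (min_le_left _ _).trans (min_le_right _ _)
  · rw [hmul]
    refine le_trans ?_ (div_sqrt_blockLength_mul_le hd hT hB)
    gcongr
    calc 2 * α ≤ 2 * (d / (2 * √(blockLength d T B))) := by gcongr
      _ = _ := by field_simp
  · rw [hmul, mul_assoc]
    have := min_mul_min_le hd hT hB hs
    gcongr

lemma le_dynamicRegret_blockSequences (hd : 1 ≤ d) (hL : 0 < L) (hR : 0 < R) {S : ℝ}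
    {T : ℕ} (hT : 1 ≤ T) {B : ℝ} (hB : 0 < B) (hBd : B ≤ d * T)
    (hSd : (d : ℝ) / (2 * √(blockLength d T B)) ≤ S)
    (hLd : L * ((d : ℝ) / (2 * √(blockLength d T B))) ≤ 1) (π : Policy d (ballSets d L)) :
    ((L * Real.exp (-(L ^ 2 / R ^ 2)) / 4 * (rate d T B / 4) : ℝ) : EReal) ≤
      dynamicRegret π (noise R) T
        (admissible (ballSets d L) S T B ∩ blockSequences d T (blockLength d T B)) := by
  have hH := one_le_blockLength hd hT hB
  have hmul : √((d : ℝ) / (4 * blockLength d T B)) * √d = d / (2 * √(blockLength d T B)) := by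
    rw [Real.sqrt_div (by positivity), Real.sqrt_mul (by positivity), div_mul_eq_mul_div,
      Real.mul_self_sqrt (by positivity)]
    norm_num
  refine le_dynamicRegret hd hL hR (a := √((d : ℝ) / (4 * blockLength d T B)))
    (Real.sqrt_nonneg _) hH (Real.sq_sqrt (by positivity)).le π T (fun A => Set.mem_inter
      (cubeSeq_mem_admissible (Real.sqrt_nonneg _) hH A ?_ ?_ ?_)
      (cubeSeq_sqrt_mem_blockSequences _ _ A)) ?_
  · rwa [hmul]
  · rwa [hmul]
  · rw [hmul]
    refine le_trans (le_of_eq ?_) (div_sqrt_blockLength_mul_le hd hT hB)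
    field_simp
  · rw [hmul]
    have := rate_div_four_le hd hT hB hBd
    gcongr

end DriftingBandit

end

theorem theorem1 (R L S : ℝ) (hR : 0 < R) (hL : 0 < L) (hS : 0 < S) :
    ∃ c : ℝ, 0 < c ∧
      -- all dimensions, horizons and budgets at once, with one constant
      (∀ d T : ℕ, 1 ≤ d → d ≤ T → ∀ B : ℝ, 0 < B →
        ∀ π : DriftingBandit.Policy d (DriftingBandit.ballSets d L),
          ((c * min (T : ℝ) (DriftingBandit.rate d T B) : ℝ) : EReal) ≤
            DriftingBandit.dynamicRegret π (DriftingBandit.noise R) T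
              (DriftingBandit.admissible (DriftingBandit.ballSets d L) S T B)) ∧
      -- budgets of order `T ^ ρ`: the full rate for all large `T` with the same constant, and for
      -- all `T ≥ d` with a constant that may depend on `d` and on the budgets
      (∀ d : ℕ, 1 ≤ d → ∀ (B : ℕ → ℝ) (ρ : ℝ), (∀ T, 0 < B T) → 0 < ρ → ρ < 1 →
        B =Θ[atTop] (fun T : ℕ => (T : ℝ) ^ ρ) →
          (∀ᶠ T : ℕ in atTop,
            ∀ π : DriftingBandit.Policy d (DriftingBandit.ballSets d L),
              ((c * DriftingBandit.rate d T (B T) : ℝ) : EReal) ≤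
                DriftingBandit.dynamicRegret π (DriftingBandit.noise R) T
                  (DriftingBandit.admissible (DriftingBandit.ballSets d L) S T (B T))) ∧
          ∃ c' : ℝ, 0 < c' ∧ ∀ T : ℕ, d ≤ T →
            ∀ π : DriftingBandit.Policy d (DriftingBandit.ballSets d L),
              ((c' * DriftingBandit.rate d T (B T) : ℝ) : EReal) ≤
                DriftingBandit.dynamicRegret π (DriftingBandit.noise R) T
                  (DriftingBandit.admissible (DriftingBandit.ballSets d L) S T (B T))) ∧
      -- the full rate is already forced by the block instances, whenever these are normalized
      (∀ d T : ℕ, 1 ≤ d → d ≤ T → ∀ B : ℝ, 0 < B → B ≤ d * T →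
        (d : ℝ) / (2 * √(DriftingBandit.blockLength d T B)) ≤ S →
        L * ((d : ℝ) / (2 * √(DriftingBandit.blockLength d T B))) ≤ 1 →
        ∀ π : DriftingBandit.Policy d (DriftingBandit.ballSets d L),
          ((c * DriftingBandit.rate d T B : ℝ) : EReal) ≤
            DriftingBandit.dynamicRegret π (DriftingBandit.noise R) T
              (DriftingBandit.admissible (DriftingBandit.ballSets d L) S T B ∩
                DriftingBandit.blockSequences d T (DriftingBandit.blockLength d T B))) := by
  have hC : 0 < L * Real.exp (-(L ^ 2 / R ^ 2)) / 4 := by positivity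
  have hs : 0 < min (min S (1 / L)) (1 / 4) := by positivity
  refine ⟨L * Real.exp (-(L ^ 2 / R ^ 2)) / 4 * min (min S (1 / L)) (1 / 4), mul_pos hC hs,
    ?_, ?_, ?_⟩
  · intro d T hd hdT B hB π
    exact DriftingBandit.le_dynamicRegret_admissible hd hL hR hS (hd.trans hdT) hB π
  · intro d hd B ρ hB _ hρ hBρ
    have hev := DriftingBandit.eventually_rate_le (d := d) hB hρ hBρ.1
    refine ⟨?_, ?_⟩
    · filter_upwards [hev, eventually_ge_atTop 1] with T hT hT1 π
      have := DriftingBandit.le_dynamicRegret_admissible hd hL hR hS hT1 (hB T) π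
      rwa [min_eq_right hT] at this
    · obtain ⟨k, hk, hkT⟩ := DriftingBandit.exists_pos_mul_rate_le hB hev
      refine ⟨_, mul_pos (mul_pos hC hs) hk, fun T hdT π => ?_⟩
      refine le_trans (EReal.coe_le_coe_iff.2 ?_) (DriftingBandit.le_dynamicRegret_admissible
        hd hL hR hS (hd.trans hdT) (hB T) π)
      rw [mul_assoc]
      exact mul_le_mul_of_nonneg_left (hkT T (hd.trans hdT)) (mul_pos hC hs).le
  · intro d T hd hdT B hB hBd hSd hLd π
    refine le_trans (EReal.coe_le_coe_iff.2 ?_) (DriftingBandit.le_dynamicRegret_blockSequences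
      hd hL hR (hd.trans hdT) hB hBd hSd hLd π)
    -- The common constant contains a factor at most `1 / 4`, which is the loss allowed by
    -- `rate_div_four_le`.
    have := min_le_right (min S (1 / L)) (1 / 4 : ℝ)
    have hr := DriftingBandit.rate_nonneg d T hB
    calc _ ≤ L * Real.exp (-(L ^ 2 / R ^ 2)) / 4 * (1 / 4) * DriftingBandit.rate d T B := by gcongr
      _ = _ := by ring
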